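/- Let $\{X(t),\,t\ge 0\}$ be a time-homogeneous continuous-time Markov process with finite state space $E$, defined on a probability space, with almost surely càdlàg (i.e. right-continuous, piecewise constant) paths. Let $\alpha_i=\mathbb P[X(0)=i]$ be its initial probabilities and $P_{i,j}(t)$ its transition probability functions (a semigroup of stochastic matrices with $P(0)=I$), and let $\mathbf Q=(q_{i,j})_{i,j\in E}$ be its generator matrix: $q_{i,j}=\lim_{h\downarrow 0}P_{i,j}(h)/h$ for $i\ne j$ and $q_{i,i}=\lim_{h\downarrow 0}(P_{i,i}(h)-1)/h$. Let $E=W\cup F$ with $W\cap F=\emptyset$ ($W$: working states, $F$: failure states). Let $N_f(t)$ be the number of transitions of $X$ in $(0,t]$ from a state of $W$ to a state of $F$ (failures), $N_r(t)$ the number of those from a state of $F$ to a state of $W$ (repairs), and $N_i(t)$ the number of those between two different states of $W$ or between two different states of $F$. The expectations of $N_f(t),N_r(t),N_i(t)$ are finite for all $t\ge0$, and for every $t\ge 0$ the limits $$\mathrm{rof}(t)=\lim_{\Delta t\to 0}\frac{\mathbb E[N_f(t+\Delta t)-N_f(t)]}{\Delta t},\quad \mathrm{ror}(t)=\lim_{\Delta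 t\to 0}\frac{\mathbb E[N_r(t+\Delta t)-N_r(t)]}{\Delta t},\quad \mathrm{roi}(t)=\lim_{\Delta t\to 0}\frac{\mathbb E[N_i(t+\Delta t)-N_i(t)]}{\Delta t}$$ (with $\Delta t\downarrow 0$ when $t=0$) exist and satisfy $$\mathrm{roi}(t)+\mathrm{rof}(t)+\mathrm{ror}(t)=\sum_{i\in E}\sum_{h\in E}\alpha_i\big(e^{t\mathbf Q}\big)_{i,h}\sum_{j\neq h}q_{h,j}=:\mathrm{tmr}(t).$$ In particular the sum of the three rates, the total mobility rate $\mathrm{tmr}(t)$, does not depend on the partition of $E$ into $W$ and $F$. -/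

import Mathlib

open MeasureTheory Filter Topology
open scoped NNReal

namespace MarkovReliability

/-- Transition probability functions `P t i j` of a time-homogeneous Markov process with finite
state space `E`: a semigroup of stochastic matrices with `P 0` the identity. -/
structure IsTransitionFunction {E : Type*} [Fintype E] [DecidableEq E]
    (P : ℝ≥0 → Matrix E E ℝ) : Prop where
  nonneg : ∀ t i j, 0 ≤ P t i j
  row_sum : ∀ t i, ∑ j, P t i j = 1
  zero : P 0 = 1
  add : ∀ s t, P (s + t) = P s * P t

/-- `Q` is the generator of `P`:  `q i j = lim P i j (h) / h` for `i ≠ j` and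
`q i i = lim (P i i (h) - 1) / h`, as `h` decreases to `0`. -/
def IsGeneratorOf {E : Type*} [DecidableEq E]
    (Q : Matrix E E ℝ) (P : ℝ≥0 → Matrix E E ℝ) : Prop :=
  ∀ i j, Tendsto (fun h : ℝ≥0 => (P h i j - (1 : Matrix E E ℝ) i j) / (h : ℝ)) (𝓝[>] 0)
    (𝓝 (Q i j))

/-- The past up to time `s`: the sigma-algebra generated by `X u`, `u ≤ s`
(`E` carries the discrete sigma-algebra). -/
abbrev past {Ω E : Type*} (X : ℝ≥0 → Ω → E) (s : ℝ≥0) : MeasurableSpace Ω :=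
  ⨆ u : ℝ≥0, ⨆ _ : u ≤ s, MeasurableSpace.comap (X u) ⊤

/-- A path is càdlàg for the discrete topology on `E`.  Such a path is piecewise constant, with
finitely many jumps in every bounded time interval. -/
def IsCadlagPath {E : Type*} (x : ℝ≥0 → E) : Prop :=
  (∀ t, ∀ᶠ u in 𝓝[>] t, x u = x t) ∧ ∀ t, 0 < t → ∃ i, ∀ᶠ u in 𝓝[<] t, x u = i

/-- `X` is a time-homogeneous continuous-time Markov (jump) process on the finite state space `E`,
with vector of initial probabilities `α` and generator matrix `Q`.  The Markov property says that,
given `X s = i` and any event `A` of the past up to time `s`, the probability of `X (s + t) = j`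
is `P t i j`. -/
structure IsMarkovProcess {Ω E : Type*} [MeasurableSpace Ω] [Fintype E] [DecidableEq E]
    (μ : Measure Ω) (X : ℝ≥0 → Ω → E) (α : E → ℝ) (Q : Matrix E E ℝ) : Prop where
  measurable : ∀ t i, MeasurableSet (X t ⁻¹' {i})
  cadlag : ∀ᵐ ω ∂μ, IsCadlagPath (fun t => X t ω)
  initial : ∀ i, μ.real (X 0 ⁻¹' {i}) = α i
  markov : ∃ P : ℝ≥0 → Matrix E E ℝ, IsTransitionFunction P ∧ IsGeneratorOf Q P ∧
    ∀ (s t : ℝ≥0) (i j : E) (A : Set Ω), MeasurableSet[past X s] A →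
      μ.real (A ∩ X s ⁻¹' {i} ∩ X (s + t) ⁻¹' {j}) = μ.real (A ∩ X s ⁻¹' {i}) * P t i j

/-- The path `x` makes a transition from `i` to `j ≠ i` at time `u > 0`. -/
def JumpsAt {E : Type*} (x : ℝ≥0 → E) (u : ℝ≥0) (i j : E) : Prop :=
  0 < u ∧ i ≠ j ∧ (∀ᶠ v in 𝓝[<] u, x v = i) ∧ x u = j

/-- Number of failures up to time `t`: transitions from a state of `W` to a state of `F`. -/
noncomputable def numFailures {Ω E : Type*} (X : ℝ≥0 → Ω → E) (W F : Set E)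
    (t : ℝ≥0) (ω : Ω) : ℕ :=
  {u : ℝ≥0 | u ≤ t ∧ ∃ w ∈ W, ∃ f ∈ F, JumpsAt (fun v => X v ω) u w f}.ncard

/-- Number of repairs up to time `t`: transitions from a state of `F` to a state of `W`. -/
noncomputable def numRepairs {Ω E : Type*} (X : ℝ≥0 → Ω → E) (W F : Set E)
    (t : ℝ≥0) (ω : Ω) : ℕ :=
  {u : ℝ≥0 | u ≤ t ∧ ∃ f ∈ F, ∃ w ∈ W, JumpsAt (fun v => X v ω) u f w}.ncard

/-- Number of transitions up to time `t` between two different states of `W` or between two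
different states of `F`. -/
noncomputable def numInner {Ω E : Type*} (X : ℝ≥0 → Ω → E) (W F : Set E)
    (t : ℝ≥0) (ω : Ω) : ℕ :=
  {u : ℝ≥0 | u ≤ t ∧
    ((∃ w ∈ W, ∃ w₁ ∈ W, JumpsAt (fun v => X v ω) u w w₁) ∨
      (∃ f ∈ F, ∃ f₁ ∈ F, JumpsAt (fun v => X v ω) u f f₁))}.ncard

/-- The difference quotient `E[N (t + δ) - N t] / δ`. -/
noncomputable def incrementRatio {Ω : Type*} [MeasurableSpace Ω] (μ : Measure Ω)
    (N : ℝ≥0 → Ω → ℕ) (t : ℝ≥0) (δ : ℝ) : ℝ :=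
  (∫ ω, ((N ((t : ℝ) + δ).toNNReal ω : ℝ) - (N t ω : ℝ)) ∂μ) / δ

/-- The filter `δ → 0`, `δ ≠ 0`, through increments with `t + δ ≥ 0`: two-sided for `t > 0`,
and `δ ↓ 0` for `t = 0`. -/
def increments (t : ℝ≥0) : Filter ℝ := 𝓝[{δ : ℝ | δ ≠ 0 ∧ 0 ≤ (t : ℝ) + δ}] 0

/-- The rate of occurrence `lim_{δ → 0} E[N (t + δ) - N t] / δ` of a counting process `N`. -/
noncomputable def rate {Ω : Type*} [MeasurableSpace Ω] (μ : Measure Ω)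
    (N : ℝ≥0 → Ω → ℕ) (t : ℝ≥0) : ℝ :=
  limUnder (increments t) (incrementRatio μ N t)

/-- The rate of occurrence of failures (ROCOF). -/
noncomputable def rof {Ω E : Type*} [MeasurableSpace Ω] (μ : Measure Ω) (X : ℝ≥0 → Ω → E)
    (W F : Set E) (t : ℝ≥0) : ℝ := rate μ (numFailures X W F) t

/-- The rate of occurrence of repairs (ROCOR). -/
noncomputable def ror {Ω E : Type*} [MeasurableSpace Ω] (μ : Measure Ω) (X : ℝ≥0 → Ω → E)
    (W F : Set E) (t : ℝ≥0) : ℝ := rate μ (numRepairs X W F) t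

/-- The rate of inoccurrence (ROI). -/
noncomputable def roi {Ω E : Type*} [MeasurableSpace Ω] (μ : Measure Ω) (X : ℝ≥0 → Ω → E)
    (W F : Set E) (t : ℝ≥0) : ℝ := rate μ (numInner X W F) t

/-- The total mobility rate; it does not involve a partition of the state space. -/
noncomputable def tmr {E : Type*} [Fintype E] [DecidableEq E] (α : E → ℝ) (Q : Matrix E E ℝ)
    (t : ℝ≥0) : ℝ :=
  ∑ i, ∑ h, α i * (NormedSpace.exp ((t : ℝ) • Q)) i h * ∑ j with j ≠ h, Q h j

end MarkovReliability

namespace MarkovReliability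

/-! All three counts are instances of one count, the jumps whose end states are related by some `R`,
and its rate at time `t` is the sum of `P(X t = i) * Q i j` over `R`-related pairs `i ≠ j`.

To find it, sample the path on a dyadic grid of mesh `h = L / 2 ^ n` over `[s, s + L]`. A càdlàg
path is locally a step with at most one jump, so by compactness a fine grid sees every jump
(`IsCadlagPath.exists_mesh`). The expected grid count is a sum of terms `P(X (s + k h) = i) * P h i
j`, and `2 ^ n * P h i j → L * Q i j`. Fatou's lemma makes the total number of jumps integrable; it
dominates all grid counts, so expectations pass to the limit. As state probabilities are continuous,
they are almost constant on a short interval, so `abs_integral_ncard_sub_le` gives the rate without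
any integral formula for the mean count.

The three relations partition the pairs of different states, and `P(X t = h)` is computed from `P t
= exp (t Q)`. -/

/-- The times in `(a, b]` at which the path `x` makes a transition related by `R`. -/
def jumpTimes {E : Type*} (x : ℝ≥0 → E) (R : E → E → Prop) (a b : ℝ≥0) : Set ℝ≥0 :=
  {u | a < u ∧ u ≤ b ∧ ∃ i j, R i j ∧ JumpsAt x u i j}

open Classical in
/-- The number of `k < n` such that `x` takes different, `R`-related values at the times
`s + k * h` and `s + (k + 1) * h`. -/
noncomputable def skeletonCount {E : Type*} (x : ℝ≥0 → E) (R : E → E → Prop) (s h : ℝ≥0)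
    (n : ℕ) : ℕ :=
  ∑ k ∈ Finset.range n, if R (x (s + k * h)) (x (s + (k + 1 : ℕ) * h)) ∧
    x (s + k * h) ≠ x (s + (k + 1 : ℕ) * h) then 1 else 0

/-! ### Jumps of a single càdlàg path and its dyadic skeletons. -/

section Path

variable {E : Type*} {x : ℝ≥0 → E} {R : E → E → Prop}

lemma nhdsLT_neBot_of_pos {u : ℝ≥0} (hu : 0 < u) : (𝓝[<] u).NeBot :=
  nhdsLT_neBot_of_exists_lt ⟨0, hu⟩

lemma JumpsAt.eq_of_eventually {u : ℝ≥0} {i j k : E} (h : JumpsAt x u i j)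
    (hk : ∀ᶠ v in 𝓝[<] u, x v = k) : i = k := by
  have := nhdsLT_neBot_of_pos h.1
  obtain ⟨v, h1, h2⟩ := (h.2.2.1.and hk).exists
  exact h1.symm.trans h2

lemma not_jumpsAt_of_const {a u : ℝ≥0} {c : E} (hau : a < u)
    (hc : ∀ v, a < v → v ≤ u → x v = c) (i j : E) : ¬ JumpsAt x u i j := by
  intro h
  have h1 : i = c := h.eq_of_eventually <| by
    filter_upwards [Ioo_mem_nhdsLT hau] with v hv using hc v hv.1 hv.2.le
  exact h.2.1 (h1.trans ((hc u hau le_rfl).symm.trans h.2.2.2))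

open Classical in
lemma jumpTimes_of_split {a b u : ℝ≥0} {i j : E} (hau : a < u) (hub : u ≤ b)
    (hi : ∀ v, a ≤ v → v < u → x v = i) (hj : ∀ v, u ≤ v → v ≤ b → x v = j) :
    jumpTimes x R a b = if R i j ∧ i ≠ j then {u} else ∅ := by
  have hleft : ∀ᶠ v in 𝓝[<] u, x v = i := by
    filter_upwards [Ioo_mem_nhdsLT hau] with v hv using hi v hv.1.le hv.2
  have key : ∀ v, v ∈ jumpTimes x R a b → v = u ∧ R i j ∧ i ≠ j := by
    rintro v ⟨hav, hvb, i', j', hR, hJ⟩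
    rcases lt_trichotomy v u with h | rfl | h
    · exact absurd hJ (not_jumpsAt_of_const (c := i) hav
        (fun w h1 h2 => hi w h1.le (h2.trans_lt h)) _ _)
    · obtain rfl := hJ.eq_of_eventually hleft
      obtain rfl := hJ.2.2.2.symm.trans (hj v le_rfl hub)
      exact ⟨rfl, hR, hJ.2.1⟩
    · exact absurd hJ (not_jumpsAt_of_const (c := j) h
        (fun w h1 h2 => hj w h1.le (h2.trans hvb)) _ _)
  split_ifs with h
  · refine Set.Subset.antisymm (fun v hv => (key v hv).1) ?_
    rintro v rfl
    exact ⟨hau, hub, i, j, h.1, (zero_le).trans_lt hau, h.2, hleft, hj v le_rfl hub⟩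
  · exact Set.eq_empty_of_forall_notMem fun v hv => h (key v hv).2

lemma jumpTimes_of_const {a b : ℝ≥0} {c : E} (hc : ∀ v, a ≤ v → v ≤ b → x v = c) :
    jumpTimes x R a b = ∅ := by
  refine Set.eq_empty_of_forall_notMem ?_
  rintro v ⟨hav, hvb, i, j, -, hJ⟩
  exact not_jumpsAt_of_const (c := c) hav (fun w h1 h2 => hc w h1.le (h2.trans hvb)) _ _ hJ

open Classical in
/-- On short intervals around `u` there is at most one jump, and it is seen at the end points. -/
lemma IsCadlagPath.exists_nhds_jumpTimes (hx : IsCadlagPath x) (R : E → E → Prop) (u : ℝ≥0) :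
    ∃ U : Set ℝ≥0, IsOpen U ∧ u ∈ U ∧ ∀ a ∈ U, ∀ b ∈ U, a ≤ b →
      (jumpTimes x R a b).Finite ∧
      (jumpTimes x R a b).ncard = if R (x a) (x b) ∧ x a ≠ x b then 1 else 0 := by
  obtain ⟨r, hur, hr⟩ : ∃ r > u, ∀ v, u ≤ v → v < r → x v = x u := by
    obtain ⟨r, hur, hr⟩ := (mem_nhdsGT_iff_exists_Ioo_subset).1 (hx.1 u)
    refine ⟨r, hur, fun v h1 h2 => ?_⟩
    rcases h1.eq_or_lt with rfl | h1
    · rfl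
    · exact hr ⟨h1, h2⟩
  obtain ⟨L, hLopen, huL, i, hL⟩ : ∃ L : Set ℝ≥0, IsOpen L ∧ u ∈ L ∧ ∃ i, ∀ a ∈ L, ∀ v,
      a ≤ v → v < u → x v = i := by
    -- At `u = 0` there is no left limit, but also no `v < u`, so any state serves.
    rcases (zero_le (a := u)).eq_or_lt with rfl | h0
    · exact ⟨Set.univ, isOpen_univ, trivial, x 0, fun a _ v _ h => absurd h not_lt_zero⟩
    · obtain ⟨i, hi⟩ := hx.2 u h0
      obtain ⟨l, hl, hlu⟩ := (mem_nhdsLT_iff_exists_Ioo_subset' h0).1 hi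
      exact ⟨Set.Ioi l, isOpen_Ioi, hl, i, fun a ha v h1 h2 =>
        hlu ⟨lt_of_lt_of_le ha h1, h2⟩⟩
  refine ⟨L ∩ Set.Iio r, hLopen.inter isOpen_Iio, ⟨huL, hur⟩, ?_⟩
  rintro a ⟨haL, har⟩ b ⟨hbL, hbr⟩ hab
  by_cases h : a < u ∧ u ≤ b
  · have hj : ∀ v, u ≤ v → v ≤ b → x v = x u := fun v h1 h2 => hr v h1 (h2.trans_lt hbr)
    rw [jumpTimes_of_split h.1 h.2 (hL a haL) hj, hL a haL a le_rfl h.1, hj b h.2 le_rfl]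
    split_ifs <;> simp
  · obtain ⟨c, hc⟩ : ∃ c, ∀ v, a ≤ v → v ≤ b → x v = c := by
      rcases lt_or_ge a u with h1 | h1
      · have h2 : b < u := not_le.1 fun h2 => h ⟨h1, h2⟩
        exact ⟨i, fun v h3 h4 => hL a haL v h3 (h4.trans_lt h2)⟩
      · exact ⟨x u, fun v h3 h4 => hr v (h1.trans h3) (h4.trans_lt hbr)⟩
    rw [jumpTimes_of_const hc, hc a le_rfl hab, hc b hab le_rfl]
    simp

lemma jumpTimes_union {a b c : ℝ≥0} (hab : a ≤ b) (hbc : b ≤ c) :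
    jumpTimes x R a c = jumpTimes x R a b ∪ jumpTimes x R b c := by
  ext u
  constructor
  · rintro ⟨h1, h2, h3⟩
    rcases le_or_gt u b with h | h
    · exact Or.inl ⟨h1, h, h3⟩
    · exact Or.inr ⟨h, h2, h3⟩
  · rintro (⟨h1, h2, h3⟩ | ⟨h1, h2, h3⟩)
    · exact ⟨h1, h2.trans hbc, h3⟩
    · exact ⟨hab.trans_lt h1, h2, h3⟩

lemma jumpTimes_disjoint {a b c : ℝ≥0} :
    Disjoint (jumpTimes x R a b) (jumpTimes x R b c) :=
  Set.disjoint_left.2 fun _ h1 h2 => absurd h1.2.1 (not_le.2 h2.1)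

/-- On a bounded interval a càdlàg path has finitely many jumps, and fine skeletons count them. -/
lemma IsCadlagPath.exists_mesh (hx : IsCadlagPath x) (R : E → E → Prop) (s L : ℝ≥0) :
    ∃ δ > 0, ∀ (h : ℝ≥0) (n : ℕ), h < δ → n * h ≤ L →
      (jumpTimes x R s (s + n * h)).Finite ∧
      (jumpTimes x R s (s + n * h)).ncard = skeletonCount x R s h n := by
  classical
  choose U hUo hUm hU using hx.exists_nhds_jumpTimes R
  -- A Lebesgue number of the cover: each grid step shorter than `δ` stays inside a single `U u`.
  obtain ⟨δ, hδ, hδU⟩ := lebesgue_number_lemma_of_metric (isCompact_Icc (a := s) (b := s + L))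
    hUo (fun u _ => Set.mem_iUnion.2 ⟨u, hUm u⟩)
  refine ⟨δ.toNNReal, Real.toNNReal_pos.2 hδ, fun h n hh => ?_⟩
  have hhδ : (h : ℝ) < δ := by
    have := NNReal.coe_lt_coe.2 hh
    rwa [Real.coe_toNNReal _ hδ.le] at this
  induction n with
  | zero =>
    intro _
    rw [jumpTimes_of_const (c := x s)]
    · simp [skeletonCount]
    · intro v h1 h2
      rw [le_antisymm (h2.trans_eq (by simp)) h1]
  | succ n ih =>
    intro hn
    have hle : (n : ℝ≥0) * h ≤ (n + 1 : ℕ) * h := by gcongr; simp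
    obtain ⟨f1, c1⟩ := ih (hle.trans hn)
    have e : s + (n + 1 : ℕ) * h = s + n * h + h := by push_cast; ring
    obtain ⟨u, hu⟩ := hδU (s + n * h) ⟨by simp, by gcongr; exact hle.trans hn⟩
    obtain ⟨f2, c2⟩ := hU u (s + n * h) (hu (Metric.mem_ball_self hδ))
      (s + (n + 1 : ℕ) * h) (hu (by rw [Metric.mem_ball, e, NNReal.dist_eq]; simpa using hhδ))
      (by gcongr)
    rw [jumpTimes_union (b := s + n * h) (by simp) (by gcongr)]
    refine ⟨f1.union f2, ?_⟩
    rw [Set.ncard_union_eq jumpTimes_disjoint f1 f2, c1, c2, skeletonCount, skeletonCount,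
      Finset.sum_range_succ]

lemma tendsto_div_two_pow (L : ℝ≥0) : Tendsto (fun n : ℕ => L / 2 ^ n) atTop (𝓝 0) := by
  rw [← NNReal.tendsto_coe]
  have := (tendsto_pow_atTop_nhds_zero_of_lt_one (r := (1 / 2 : ℝ)) (by norm_num)
    (by norm_num)).const_mul (L : ℝ)
  simpa [div_eq_mul_inv] using this

lemma IsCadlagPath.finite_jumpTimes (hx : IsCadlagPath x) (R : E → E → Prop) (s L : ℝ≥0) :
    (jumpTimes x R s (s + L)).Finite := by
  obtain ⟨δ, hδ, H⟩ := hx.exists_mesh R s L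
  obtain ⟨n, hn⟩ := ((tendsto_div_two_pow L).eventually_lt_const hδ).exists
  have e : ((2 ^ n : ℕ) : ℝ≥0) * (L / 2 ^ n) = L := by push_cast; field_simp
  have := (H (L / 2 ^ n) (2 ^ n) hn e.le).1
  rwa [e] at this

lemma IsCadlagPath.eventually_skeletonCount (hx : IsCadlagPath x) (R : E → E → Prop)
    (s L : ℝ≥0) : ∀ᶠ n : ℕ in atTop,
      skeletonCount x R s (L / 2 ^ n) (2 ^ n) = (jumpTimes x R s (s + L)).ncard := by
  obtain ⟨δ, hδ, H⟩ := hx.exists_mesh R s L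
  filter_upwards [(tendsto_div_two_pow L).eventually_lt_const hδ] with n hn
  have e : ((2 ^ n : ℕ) : ℝ≥0) * (L / 2 ^ n) = L := by push_cast; field_simp
  have := (H (L / 2 ^ n) (2 ^ n) hn e.le).2
  rw [e] at this
  exact this.symm

lemma skeletonCount_mono_rel {R' : E → E → Prop} (h : ∀ i j, R i j → R' i j) (s d : ℝ≥0) (n : ℕ) :
    skeletonCount x R s d n ≤ skeletonCount x R' s d n := by
  classical
  refine Finset.sum_le_sum fun k _ => ?_
  split_ifs with h1 h2
  · exact le_rfl
  · exact absurd ⟨h _ _ h1.1, h1.2⟩ h2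
  · exact zero_le_one
  · exact le_rfl

lemma sum_range_two_mul {M : Type*} [AddCommMonoid M] (f : ℕ → M) (n : ℕ) :
    ∑ k ∈ Finset.range (2 * n), f k = ∑ k ∈ Finset.range n, (f (2 * k) + f (2 * k + 1)) := by
  induction n with
  | zero => simp
  | succ n ih =>
    rw [Nat.mul_succ, Finset.sum_range_succ, Finset.sum_range_succ, ih, Finset.sum_range_succ,
      add_assoc]

/-- If the ends of a step differ, the midpoint differs from at least one of them, so halving the
mesh loses no change. The halves of an `R`-related step need not be `R`-related, which is why the
dominating count uses the trivial relation. -/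
lemma monotone_skeletonCount (x : ℝ≥0 → E) (s L : ℝ≥0) :
    Monotone fun n : ℕ => skeletonCount x (fun _ _ => True) s (L / 2 ^ n) (2 ^ n) := by
  classical
  refine monotone_nat_of_le_succ fun n => ?_
  simp only [skeletonCount, pow_succ' 2 n, sum_range_two_mul]
  refine Finset.sum_le_sum fun k _ => ?_
  have e0 : s + (2 * k : ℕ) * (L / 2 ^ (n + 1)) = s + k * (L / 2 ^ n) := by
    push_cast; rw [pow_succ']; field_simp
  have e1 : s + (2 * k + 1 + 1 : ℕ) * (L / 2 ^ (n + 1)) = s + (k + 1 : ℕ) * (L / 2 ^ n) := by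
    push_cast; rw [pow_succ']; field_simp; ring
  rw [e0, e1]
  simp only [true_and]
  split_ifs with h1 h2 h3 <;> first | omega | simp_all

lemma IsCadlagPath.skeletonCount_le (hx : IsCadlagPath x) (R : E → E → Prop) (s L : ℝ≥0) (n : ℕ) :
    skeletonCount x R s (L / 2 ^ n) (2 ^ n) ≤
      (jumpTimes x (fun _ _ => True) s (s + L)).ncard := by
  obtain ⟨m, hm, hnm⟩ := ((hx.eventually_skeletonCount (fun _ _ => True) s L).and
    (eventually_ge_atTop n)).exists
  rw [← hm]
  exact (skeletonCount_mono_rel (fun _ _ _ => trivial) _ _ _).trans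
    (monotone_skeletonCount x s L hnm)

end Path

/-! ### Contraction semigroups in a Banach algebra. -/

section Contraction

variable {A : Type*} [NormedRing A] [NormedAlgebra ℝ A] {P : ℝ≥0 → A} {Q : A}

lemma tendsto_coe_nhdsGT_zero : Tendsto (fun h : ℝ≥0 => (h : ℝ)) (𝓝[>] 0) (𝓝 0) :=
  (NNReal.continuous_coe.tendsto' 0 0 rfl).mono_left nhdsWithin_le_nhds

lemma tendsto_toNNReal_nhdsGT_zero :
    Tendsto Real.toNNReal (𝓝[>] (0 : ℝ)) (𝓝[>] (0 : ℝ≥0)) := by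
  refine tendsto_nhdsWithin_iff.2 ⟨?_, ?_⟩
  · exact (continuous_real_toNNReal.tendsto' 0 0 (by simp)).mono_left nhdsWithin_le_nhds
  · filter_upwards [self_mem_nhdsWithin] with h hh using Real.toNNReal_pos.2 hh

lemma tendsto_norm_semigroup_sub_one (h0 : P 0 = 1)
    (hQ : Tendsto (fun h : ℝ≥0 => (h : ℝ)⁻¹ • (P h - 1)) (𝓝[>] 0) (𝓝 Q)) :
    Tendsto (fun h : ℝ≥0 => ‖P h - 1‖) (𝓝 0) (𝓝 0) := by
  have h1 : Tendsto (fun h : ℝ≥0 => ‖P h - 1‖) (𝓝[>] 0) (𝓝 0) := by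
    have := (tendsto_coe_nhdsGT_zero.smul hQ).norm
    rw [zero_smul, norm_zero] at this
    refine this.congr' ?_
    filter_upwards [self_mem_nhdsWithin] with h hh
    rw [smul_inv_smul₀]
    exact (NNReal.coe_pos.2 hh).ne'
  -- The generator limit only sees `h > 0`; the point `0` is covered by `P 0 = 1`.
  have h2 : (𝓝 (0 : ℝ≥0)) = pure 0 ⊔ 𝓝[>] 0 := by
    rw [← nhdsWithin_insert, Set.Ioi_insert]
    have : Set.Ici (0 : ℝ≥0) = Set.univ := Set.eq_univ_of_forall fun x => Set.mem_Ici.2 zero_le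
    rw [this, nhdsWithin_univ]
  rw [h2]
  refine Tendsto.sup ?_ h1
  rw [tendsto_pure_left]
  intro s hs
  simpa [h0] using mem_of_mem_nhds hs

lemma continuous_of_contraction_semigroup (h0 : P 0 = 1) (hadd : ∀ s t, P (s + t) = P s * P t)
    (hle : ∀ t, ‖P t‖ ≤ 1)
    (hQ : Tendsto (fun h : ℝ≥0 => (h : ℝ)⁻¹ • (P h - 1)) (𝓝[>] 0) (𝓝 Q)) : Continuous P := by
  have aux : ∀ s h : ℝ≥0, ‖P (s + h) - P s‖ ≤ ‖P h - 1‖ := fun s h => by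
    calc ‖P (s + h) - P s‖ = ‖P s * (P h - 1)‖ := by rw [hadd, mul_sub, mul_one]
      _ ≤ ‖P s‖ * ‖P h - 1‖ := norm_mul_le _ _
      _ ≤ 1 * ‖P h - 1‖ := by gcongr; exact hle s
      _ = _ := one_mul _
  -- One of the two truncated differences is zero, so their sum is `|s - t|`; the bound from `aux`
  -- thus gives left and right continuity together.
  have key : ∀ s t : ℝ≥0, dist (P s) (P t) ≤ ‖P ((s - t) + (t - s)) - 1‖ := by
    intro s t
    rcases le_total s t with h | h
    · have := aux s (t - s)
      rw [add_tsub_cancel_of_le h] at this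
      rwa [tsub_eq_zero_of_le h, zero_add, dist_comm, dist_eq_norm]
    · have := aux t (s - t)
      rw [add_tsub_cancel_of_le h] at this
      rwa [tsub_eq_zero_of_le h, add_zero, dist_eq_norm]
  refine continuous_iff_continuousAt.2 fun t => tendsto_iff_dist_tendsto_zero.2 ?_
  refine squeeze_zero (fun _ => dist_nonneg) (fun s => key s t) ?_
  refine (tendsto_norm_semigroup_sub_one h0 hQ).comp ?_
  exact Continuous.tendsto' (by fun_prop) _ _ (by simp)

lemma hasDerivWithinAt_semigroup (hadd : ∀ s t, P (s + t) = P s * P t)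
    (hQ : Tendsto (fun h : ℝ≥0 => (h : ℝ)⁻¹ • (P h - 1)) (𝓝[>] 0) (𝓝 Q)) {s : ℝ} (hs : 0 ≤ s) :
    HasDerivWithinAt (fun u : ℝ => P u.toNNReal) (P s.toNNReal * Q) (Set.Ici s) s := by
  rw [← hasDerivWithinAt_Ioi_iff_Ici, hasDerivWithinAt_iff_tendsto_slope' Set.self_notMem_Ioi]
  have h1 : Tendsto (fun u : ℝ => u - s) (𝓝[>] s) (𝓝[>] 0) := by
    refine tendsto_nhdsWithin_iff.2 ⟨?_, ?_⟩
    · exact (Continuous.tendsto' (by fun_prop) _ _ (by simp)).mono_left nhdsWithin_le_nhds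
    · filter_upwards [self_mem_nhdsWithin] with u hu using Set.mem_Ioi.2 (sub_pos.2 (Set.mem_Ioi.1 hu))
  refine ((hQ.comp (tendsto_toNNReal_nhdsGT_zero.comp h1)).const_mul (P s.toNNReal)).congr' ?_
  filter_upwards [self_mem_nhdsWithin] with u hu
  have hu' : s < u := hu
  have e : u.toNNReal = s.toNNReal + (u - s).toNNReal := by
    rw [← Real.toNNReal_add hs (sub_nonneg.2 hu'.le)]; congr 1; ring
  simp only [Function.comp, slope, vsub_eq_sub]
  rw [Real.coe_toNNReal _ (sub_nonneg.2 hu'.le), e, hadd, mul_smul_comm, mul_sub, mul_one]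

/-- A contraction semigroup in a Banach algebra is the exponential of its generator. -/
theorem eq_exp_of_contraction_semigroup [CompleteSpace A] (h0 : P 0 = 1)
    (hadd : ∀ s t, P (s + t) = P s * P t) (hle : ∀ t, ‖P t‖ ≤ 1)
    (hQ : Tendsto (fun h : ℝ≥0 => (h : ℝ)⁻¹ • (P h - 1)) (𝓝[>] 0) (𝓝 Q)) (t : ℝ≥0) :
    P t = NormedSpace.exp ((t : ℝ) • Q) := by
  let _ : NormedAlgebra ℚ A := NormedAlgebra.restrictScalars ℚ ℝ A
  have hexp : ∀ s : ℝ, HasDerivAt (fun u : ℝ => NormedSpace.exp (u • (-Q)))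
      ((-Q) * NormedSpace.exp (s • (-Q))) s := fun s => hasDerivAt_exp_smul_const' (-Q) s
  -- The product `P u * exp (-u Q)` is continuous with zero right derivative, hence constantly `1`.
  have hconst := constant_of_has_deriv_right_zero
    (f := fun u : ℝ => P u.toNNReal * NormedSpace.exp (u • (-Q))) (a := 0) (b := t)
    (((continuous_of_contraction_semigroup h0 hadd hle hQ).comp continuous_real_toNNReal).mul
      (continuous_iff_continuousAt.2 fun s => (hexp s).continuousAt)).continuousOn
    (fun s hs => by
      have := (hasDerivWithinAt_semigroup hadd hQ hs.1).mul (hexp s).hasDerivWithinAt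
      have e : P s.toNNReal * Q * NormedSpace.exp (s • (-Q)) +
          P s.toNNReal * (-Q * NormedSpace.exp (s • (-Q))) = 0 := by noncomm_ring
      rwa [e] at this) t ⟨t.2, le_rfl⟩
  simp only [Real.toNNReal_coe, Real.toNNReal_zero, h0, zero_smul, NormedSpace.exp_zero,
    mul_one] at hconst
  have h2 : NormedSpace.exp ((t : ℝ) • (-Q)) * NormedSpace.exp ((t : ℝ) • Q) = 1 := by
    rw [smul_neg, ← NormedSpace.exp_add_of_commute (Commute.refl ((t : ℝ) • Q)).neg_left]
    simp
  calc P t = P t * (NormedSpace.exp ((t : ℝ) • (-Q)) * NormedSpace.exp ((t : ℝ) • Q)) := by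
        rw [h2, mul_one]
    _ = _ := by rw [← mul_assoc, hconst, one_mul]

end Contraction

/-! ### Stochastic semigroups as matrix exponentials. -/

section Semigroup

variable {E : Type*} [Fintype E] [DecidableEq E] {P : ℝ≥0 → Matrix E E ℝ} {Q : Matrix E E ℝ}

lemma IsGeneratorOf.tendsto_matrix {E : Type*} [DecidableEq E] {P : ℝ≥0 → Matrix E E ℝ}
    {Q : Matrix E E ℝ} (hQ : IsGeneratorOf Q P) :
    Tendsto (fun h : ℝ≥0 => (h : ℝ)⁻¹ • (P h - 1)) (𝓝[>] 0) (𝓝 Q) := by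
  refine tendsto_pi_nhds.2 fun i => tendsto_pi_nhds.2 fun j => ?_
  simpa [div_eq_inv_mul] using hQ i j

attribute [local instance] Matrix.linftyOpNormedRing Matrix.linftyOpNormedAlgebra

/-- The operator norm for the sup norm is the largest absolute row sum, which makes stochastic
matrices contractions. -/
lemma IsTransitionFunction.norm_le_one (hP : IsTransitionFunction P) (t : ℝ≥0) :
    ‖P t‖ ≤ 1 := by
  rw [Matrix.linfty_opNorm_def]
  have : (Finset.univ.sup fun i : E => ∑ j, ‖P t i j‖₊) ≤ 1 := by
    refine Finset.sup_le fun i _ => ?_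
    rw [← NNReal.coe_le_coe, NNReal.coe_sum]
    simp only [coe_nnnorm, NNReal.coe_one]
    rw [← hP.row_sum t i]
    exact Finset.sum_le_sum fun j _ => by
      rw [Real.norm_of_nonneg (hP.nonneg t i j)]
  exact_mod_cast this

lemma IsTransitionFunction.continuous (hP : IsTransitionFunction P) (hQ : IsGeneratorOf Q P) :
    Continuous P :=
  continuous_of_contraction_semigroup hP.zero hP.add hP.norm_le_one hQ.tendsto_matrix

/-- The transition function of a finite state space is the exponential of its generator. -/
theorem IsTransitionFunction.eq_exp (hP : IsTransitionFunction P) (hQ : IsGeneratorOf Q P)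
    (t : ℝ≥0) : P t = NormedSpace.exp ((t : ℝ) • Q) :=
  eq_exp_of_contraction_semigroup hP.zero hP.add hP.norm_le_one hQ.tendsto_matrix t

end Semigroup

/-! ### Grid counts as finite sums of indicators. -/

open Classical in
/-- The pairs of different states related by `R`. -/
noncomputable def offDiagPairs {E : Type*} [Fintype E] (R : E → E → Prop) : Finset (E × E) :=
  Finset.univ.filter fun q => R q.1 q.2 ∧ q.1 ≠ q.2

lemma ne_of_mem_offDiagPairs {E : Type*} [Fintype E] {R : E → E → Prop} {q : E × E}
    (hq : q ∈ offDiagPairs R) : q.1 ≠ q.2 := by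
  classical
  exact (Finset.mem_filter_univ q).1 hq |>.2

lemma ite_eq_sum_indicator {Ω E : Type*} [Fintype E] (R : E → E → Prop) (Y Z : Ω → E) (ω : Ω)
    {_ : Decidable (R (Y ω) (Z ω) ∧ Y ω ≠ Z ω)} :
    ((if R (Y ω) (Z ω) ∧ Y ω ≠ Z ω then 1 else 0 : ℕ) : ℝ) =
      ∑ q ∈ offDiagPairs R, (Y ⁻¹' {q.1} ∩ Z ⁻¹' {q.2}).indicator (fun _ => (1 : ℝ)) ω := by
  classical
  have : ∀ q : E × E, (Y ⁻¹' {q.1} ∩ Z ⁻¹' {q.2}).indicator (fun _ => (1 : ℝ)) ω =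
      if (Y ω, Z ω) = q then 1 else 0 := fun q => by
    simp [Set.indicator_apply, Prod.ext_iff]
  simp only [this, Finset.sum_ite_eq, offDiagPairs, Finset.mem_filter, Finset.mem_univ, true_and]
  split_ifs <;> simp

lemma sum_measureReal_inter_fiber {Ω E : Type*} [MeasurableSpace Ω] [Fintype E]
    {μ : Measure Ω} [IsFiniteMeasure μ] {Y : Ω → E}
    (hY : ∀ i, MeasurableSet (Y ⁻¹' {i})) {A : Set Ω} (hA : MeasurableSet A) :
    ∑ i, μ.real (Y ⁻¹' {i} ∩ A) = μ.real A := by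
  rw [← measureReal_biUnion_finset]
  · congr 1
    ext ω
    simp
  · intro i _ j _ hij
    refine Set.disjoint_left.2 ?_
    rintro ω ⟨h1, -⟩ ⟨h2, -⟩
    exact hij (h1.symm.trans h2)
  · exact fun i _ => (hY i).inter hA

lemma skeletonCount_eq_sum_indicator {Ω E : Type*} [Fintype E] (X : ℝ≥0 → Ω → E) (R : E → E → Prop)
    (s h : ℝ≥0) (n : ℕ) :
    (fun ω => (skeletonCount (fun v => X v ω) R s h n : ℝ)) =
      fun ω => ∑ k ∈ Finset.range n, ∑ q ∈ offDiagPairs R,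
        (X (s + k * h) ⁻¹' {q.1} ∩ X (s + (k + 1 : ℕ) * h) ⁻¹' {q.2}).indicator
          (fun _ => (1 : ℝ)) ω := by
  funext ω
  rw [skeletonCount, Nat.cast_sum]
  exact Finset.sum_congr rfl fun k _ => ite_eq_sum_indicator R (X _) (X _) ω

/-! ### Expected numbers of jumps and their rates. -/

section Rates

variable {Ω E : Type*} [MeasurableSpace Ω] [Fintype E] [DecidableEq E] {μ : Measure Ω}
  {X : ℝ≥0 → Ω → E} {α : E → ℝ} {Q : Matrix E E ℝ} {P : ℝ≥0 → Matrix E E ℝ}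

/-- Expected grid counts involve only the joint law at two times, so the past event is taken to be
`Set.univ`. -/
lemma IsMarkovProcess.exists_transition (hX : IsMarkovProcess μ X α Q) :
    ∃ P : ℝ≥0 → Matrix E E ℝ, IsTransitionFunction P ∧ IsGeneratorOf Q P ∧
      ∀ s t i j, μ.real (X s ⁻¹' {i} ∩ X (s + t) ⁻¹' {j}) = μ.real (X s ⁻¹' {i}) * P t i j := by
  obtain ⟨P, hP, hQ, hM⟩ := hX.markov
  exact ⟨P, hP, hQ, fun s t i j => by simpa using hM s t i j Set.univ MeasurableSet.univ⟩

lemma IsMarkovProcess.measureReal_state [IsFiniteMeasure μ] (hX : IsMarkovProcess μ X α Q)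
    (hM : ∀ s t i j, μ.real (X s ⁻¹' {i} ∩ X (s + t) ⁻¹' {j}) = μ.real (X s ⁻¹' {i}) * P t i j)
    (t : ℝ≥0) (h : E) : μ.real (X t ⁻¹' {h}) = ∑ i, α i * P t i h := by
  rw [← sum_measureReal_inter_fiber (hX.measurable 0) (hX.measurable t h)]
  refine Finset.sum_congr rfl fun i _ => ?_
  have := hM 0 t i h
  rwa [zero_add, hX.initial] at this

lemma integrable_skeletonCount [IsFiniteMeasure μ] (hm : ∀ t i, MeasurableSet (X t ⁻¹' {i}))
    (R : E → E → Prop) (s h : ℝ≥0) (n : ℕ) :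
    Integrable (fun ω => (skeletonCount (fun v => X v ω) R s h n : ℝ)) μ := by
  rw [skeletonCount_eq_sum_indicator]
  exact integrable_finsetSum _ fun k _ => integrable_finsetSum _ fun q _ =>
    (integrable_const _).indicator ((hm _ _).inter (hm _ _))

lemma integral_skeletonCount [IsFiniteMeasure μ] (hm : ∀ t i, MeasurableSet (X t ⁻¹' {i}))
    (hM : ∀ s t i j, μ.real (X s ⁻¹' {i} ∩ X (s + t) ⁻¹' {j}) = μ.real (X s ⁻¹' {i}) * P t i j)
    (R : E → E → Prop) (s h : ℝ≥0) (n : ℕ) :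
    ∫ ω, (skeletonCount (fun v => X v ω) R s h n : ℝ) ∂μ =
      ∑ k ∈ Finset.range n, ∑ q ∈ offDiagPairs R,
        μ.real (X (s + k * h) ⁻¹' {q.1}) * P h q.1 q.2 := by
  rw [skeletonCount_eq_sum_indicator, integral_finsetSum _ fun k _ => integrable_finsetSum _
    fun q _ => (integrable_const _).indicator ((hm _ _).inter (hm _ _))]
  refine Finset.sum_congr rfl fun k _ => ?_
  rw [integral_finsetSum _ fun q _ => (integrable_const _).indicator ((hm _ _).inter (hm _ _))]
  refine Finset.sum_congr rfl fun q _ => ?_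
  rw [integral_indicator_const _ ((hm _ _).inter (hm _ _)), smul_eq_mul, mul_one, ← hM]
  congr 4
  push_cast
  ring

lemma IsGeneratorOf.tendsto_two_pow_mul (hP : IsTransitionFunction P) (hQ : IsGeneratorOf Q P)
    (L : ℝ≥0) {i j : E} (hij : i ≠ j) :
    Tendsto (fun n : ℕ => (2 : ℝ) ^ n * P (L / 2 ^ n) i j) atTop (𝓝 (L * Q i j)) := by
  -- For `L = 0` the mesh never enters `𝓝[>] 0`; both sides vanish instead.
  rcases (zero_le (a := L)).eq_or_lt with rfl | hL
  · simp [hP.zero, Matrix.one_apply_ne hij]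
  · have h1 : Tendsto (fun n : ℕ => L / 2 ^ n) atTop (𝓝[>] 0) :=
      tendsto_nhdsWithin_iff.2 ⟨tendsto_div_two_pow L, Eventually.of_forall fun n =>
        Set.mem_Ioi.2 (by positivity)⟩
    refine (((hQ i j).comp h1).const_mul (L : ℝ)).congr fun n => ?_
    have : (L : ℝ) ≠ 0 := (NNReal.coe_pos.2 hL).ne'
    simp only [Function.comp, Matrix.one_apply_ne hij, sub_zero]
    push_cast
    field_simp

lemma IsMarkovProcess.ae_tendsto_skeletonCount (hX : IsMarkovProcess μ X α Q)
    (R : E → E → Prop) (s L : ℝ≥0) :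
    ∀ᵐ ω ∂μ, Tendsto (fun n : ℕ => (skeletonCount (fun v => X v ω) R s (L / 2 ^ n) (2 ^ n) : ℝ))
      atTop (𝓝 ((jumpTimes (fun v => X v ω) R s (s + L)).ncard : ℝ)) := by
  filter_upwards [hX.cadlag] with ω hω
  exact tendsto_const_nhds.congr' ((hω.eventually_skeletonCount R s L).mono fun n hn => by
    exact congrArg Nat.cast hn.symm)

/-- Expected grid counts are at most the sums of `2 ^ n * P (L / 2 ^ n) i j` over `i ≠ j`, which
converge and so are bounded; Fatou's lemma carries the bound to the limit. -/
lemma IsMarkovProcess.integrable_ncard_all [IsProbabilityMeasure μ]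
    (hX : IsMarkovProcess μ X α Q) (s L : ℝ≥0) :
    Integrable (fun ω => ((jumpTimes (fun v => X v ω) (fun _ _ => True) s (s + L)).ncard : ℝ))
      μ := by
  obtain ⟨P, hP, hQ, hM⟩ := hX.exists_transition
  set R : E → E → Prop := fun _ _ => True
  have hlim : Tendsto (fun n : ℕ => ∑ q ∈ offDiagPairs R, (2 : ℝ) ^ n * P (L / 2 ^ n) q.1 q.2)
      atTop (𝓝 (∑ q ∈ offDiagPairs R, L * Q q.1 q.2)) :=
    tendsto_finsetSum _ fun q hq => hQ.tendsto_two_pow_mul hP L (ne_of_mem_offDiagPairs hq)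
  obtain ⟨C, hC⟩ := hlim.bddAbove_range
  have hbound : ∀ n : ℕ, eLpNorm (fun ω =>
      (skeletonCount (fun v => X v ω) R s (L / 2 ^ n) (2 ^ n) : ℝ)) 1 μ ≤ ENNReal.ofReal C := by
    intro n
    rw [eLpNorm_one_eq_lintegral_enorm,
      ← ofReal_integral_norm_eq_lintegral_enorm (integrable_skeletonCount hX.measurable _ _ _ _)]
    refine ENNReal.ofReal_le_ofReal (le_trans ?_ (hC ⟨n, rfl⟩))
    simp only [Real.norm_natCast]
    rw [integral_skeletonCount hX.measurable hM, ← Finset.mul_sum]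
    calc _ ≤ ∑ k ∈ Finset.range (2 ^ n), ∑ q ∈ offDiagPairs R, P (L / 2 ^ n) q.1 q.2 := by
          refine Finset.sum_le_sum fun k _ => Finset.sum_le_sum fun q _ => ?_
          exact mul_le_of_le_one_left (hP.nonneg _ _ _) measureReal_le_one
      _ = _ := by simp
  have hmeas := aestronglyMeasurable_of_tendsto_ae atTop (fun n : ℕ =>
    (integrable_skeletonCount (μ := μ) hX.measurable R s (L / 2 ^ n)
      (2 ^ n)).aestronglyMeasurable) (hX.ae_tendsto_skeletonCount R s L)
  refine memLp_one_iff_integrable.1 ⟨hmeas, ?_⟩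
  refine lt_of_le_of_lt ?_ (ENNReal.ofReal_lt_top (r := C))
  refine (Lp.eLpNorm_lim_le_liminf_eLpNorm (fun n : ℕ =>
    (integrable_skeletonCount (μ := μ) hX.measurable R s (L / 2 ^ n)
      (2 ^ n)).aestronglyMeasurable) _ (hX.ae_tendsto_skeletonCount R s L)).trans ?_
  exact liminf_le_of_le (by isBoundedDefault) fun b hb =>
    let ⟨n, hn⟩ := hb.exists; hn.trans (hbound n)

lemma IsMarkovProcess.norm_skeletonCount_le (hX : IsMarkovProcess μ X α Q)
    (R : E → E → Prop) (s L : ℝ≥0) (n : ℕ) :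
    ∀ᵐ ω ∂μ, ‖(skeletonCount (fun v => X v ω) R s (L / 2 ^ n) (2 ^ n) : ℝ)‖ ≤
      ((jumpTimes (fun v => X v ω) (fun _ _ => True) s (s + L)).ncard : ℝ) := by
  filter_upwards [hX.cadlag] with ω hω
  rw [Real.norm_natCast]
  exact_mod_cast hω.skeletonCount_le R s L n

lemma IsMarkovProcess.tendsto_integral_skeletonCount [IsProbabilityMeasure μ]
    (hX : IsMarkovProcess μ X α Q) (R : E → E → Prop) (s L : ℝ≥0) :
    Tendsto (fun n : ℕ => ∫ ω, (skeletonCount (fun v => X v ω) R s (L / 2 ^ n) (2 ^ n) : ℝ) ∂μ)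
      atTop (𝓝 (∫ ω, ((jumpTimes (fun v => X v ω) R s (s + L)).ncard : ℝ) ∂μ)) :=
  tendsto_integral_of_dominated_convergence _
    (fun _ => (integrable_skeletonCount hX.measurable _ _ _ _).aestronglyMeasurable)
    (hX.integrable_ncard_all s L) (hX.norm_skeletonCount_le R s L)
    (hX.ae_tendsto_skeletonCount R s L)

/-- The number of jumps in a bounded interval has finite expectation. -/
lemma IsMarkovProcess.integrable_ncard [IsProbabilityMeasure μ]
    (hX : IsMarkovProcess μ X α Q) (R : E → E → Prop) (s L : ℝ≥0) :
    Integrable (fun ω => ((jumpTimes (fun v => X v ω) R s (s + L)).ncard : ℝ)) μ := by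
  refine (hX.integrable_ncard_all s L).mono' (aestronglyMeasurable_of_tendsto_ae atTop
    (fun n : ℕ => (integrable_skeletonCount (μ := μ) hX.measurable R s (L / 2 ^ n)
      (2 ^ n)).aestronglyMeasurable) (hX.ae_tendsto_skeletonCount R s L)) ?_
  filter_upwards [ae_all_iff.2 (hX.norm_skeletonCount_le R s L),
    hX.ae_tendsto_skeletonCount R s L] with ω h1 h2
  exact le_of_tendsto' h2.norm h1

/-- If the state probabilities stay within `ε` of `c` on `[s, s + L]`, then the expected number
of jumps in `(s, s + L]` is, up to an error of order `L * ε`, `L` times the rate given by `c`. -/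
lemma IsMarkovProcess.abs_integral_ncard_sub_le [IsProbabilityMeasure μ]
    (hX : IsMarkovProcess μ X α Q) (R : E → E → Prop) {s L : ℝ≥0} {c : E → ℝ} {ε : ℝ}
    (hc : ∀ u, s ≤ u → u ≤ s + L → ∀ i, |μ.real (X u ⁻¹' {i}) - c i| ≤ ε) :
    |∫ ω, ((jumpTimes (fun v => X v ω) R s (s + L)).ncard : ℝ) ∂μ -
      ∑ q ∈ offDiagPairs R, c q.1 * (L * Q q.1 q.2)| ≤
      ∑ q ∈ offDiagPairs R, ε * (L * Q q.1 q.2) := by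
  obtain ⟨P, hP, hQ, hM⟩ := hX.exists_transition
  have hq : ∀ q ∈ offDiagPairs R, Tendsto (fun n : ℕ => (2 : ℝ) ^ n * P (L / 2 ^ n) q.1 q.2)
      atTop (𝓝 (L * Q q.1 q.2)) := fun q hq =>
    hQ.tendsto_two_pow_mul hP L (ne_of_mem_offDiagPairs hq)
  refine le_of_tendsto_of_tendsto' ((hX.tendsto_integral_skeletonCount R s L).sub
    (tendsto_finsetSum _ fun q h => (hq q h).const_mul (c q.1))).abs
    (tendsto_finsetSum _ fun q h => (hq q h).const_mul ε) fun n => ?_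
  -- Spreading the factor `2 ^ n` over `2 ^ n` equal terms lets the sums be compared grid point by
  -- grid point.
  have e : ∀ f : E × E → ℝ, ∑ q ∈ offDiagPairs R, f q * (2 ^ n * P (L / 2 ^ n) q.1 q.2) =
      ∑ k ∈ Finset.range (2 ^ n), ∑ q ∈ offDiagPairs R, f q * P (L / 2 ^ n) q.1 q.2 := fun f => by
    rw [Finset.sum_const, Finset.card_range, nsmul_eq_mul, Finset.mul_sum]
    refine Finset.sum_congr rfl fun q _ => ?_
    push_cast
    ring
  rw [integral_skeletonCount hX.measurable hM, e (fun q => c q.1), e (fun _ => ε),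
    ← Finset.sum_sub_distrib]
  refine (Finset.abs_sum_le_sum_abs _ _).trans (Finset.sum_le_sum fun k hk => ?_)
  rw [← Finset.sum_sub_distrib]
  refine (Finset.abs_sum_le_sum_abs _ _).trans (Finset.sum_le_sum fun q _ => ?_)
  rw [← sub_mul, abs_mul, abs_of_nonneg (hP.nonneg _ _ _)]
  refine mul_le_mul_of_nonneg_right (hc _ (by simp) ?_ _) (hP.nonneg _ _ _)
  gcongr
  calc (k : ℝ≥0) * (L / 2 ^ n) ≤ 2 ^ n * (L / 2 ^ n) := by
        gcongr
        exact_mod_cast (Finset.mem_range.1 hk).le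
    _ = L := by field_simp

lemma IsMarkovProcess.integral_ncard_sub [IsProbabilityMeasure μ]
    (hX : IsMarkovProcess μ X α Q) (R : E → E → Prop) (s L : ℝ≥0) :
    ∫ ω, (((jumpTimes (fun v => X v ω) R 0 (s + L)).ncard : ℝ) -
      ((jumpTimes (fun v => X v ω) R 0 s).ncard : ℝ)) ∂μ =
      ∫ ω, ((jumpTimes (fun v => X v ω) R s (s + L)).ncard : ℝ) ∂μ := by
  refine integral_congr_ae ?_
  filter_upwards [hX.cadlag] with ω hω
  have h1 := hω.finite_jumpTimes R 0 s
  rw [zero_add] at h1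
  rw [jumpTimes_union (b := s) zero_le (by simp),
    Set.ncard_union_eq jumpTimes_disjoint h1 (hω.finite_jumpTimes R s L)]
  push_cast
  ring

lemma IsMarkovProcess.continuous_measureReal_state [IsFiniteMeasure μ]
    (hX : IsMarkovProcess μ X α Q) (i : E) : Continuous fun t => μ.real (X t ⁻¹' {i}) := by
  obtain ⟨P, hP, hQ, hM⟩ := hX.exists_transition
  simp only [hX.measureReal_state hM]
  have := hP.continuous hQ
  fun_prop

/-- The rate of the transitions related by `R`. -/
theorem IsMarkovProcess.tendsto_incrementRatio [IsProbabilityMeasure μ]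
    (hX : IsMarkovProcess μ X α Q) (R : E → E → Prop) (t : ℝ≥0) :
    Tendsto (incrementRatio μ (fun s ω => (jumpTimes (fun v => X v ω) R 0 s).ncard) t)
      (increments t) (𝓝 (∑ q ∈ offDiagPairs R, μ.real (X t ⁻¹' {q.1}) * Q q.1 q.2)) := by
  set c : E → ℝ := fun i => μ.real (X t ⁻¹' {i})
  set K : ℝ := ∑ q ∈ offDiagPairs R, Q q.1 q.2
  refine Metric.tendsto_nhds.2 fun ε hε => ?_
  -- The `+ 1` covers `K = 0`, and `|K|` avoids having to know the sign of `K`.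
  have hε' : 0 < ε / (|K| + 1) := by positivity
  have hcont : ∀ᶠ u in 𝓝 t, ∀ i, |μ.real (X u ⁻¹' {i}) - c i| < ε / (|K| + 1) :=
    eventually_all.2 fun i =>
      Metric.tendsto_nhds.1 (hX.continuous_measureReal_state i).continuousAt _ hε'
  obtain ⟨η, hη, H⟩ := Metric.eventually_nhds_iff.1 hcont
  -- Stated for any interval close to `t`, so that it serves increments to the right (`s = t`) and
  -- to the left (`s + L = t`).
  have key : ∀ s L : ℝ≥0, 0 < L → (∀ u, s ≤ u → u ≤ s + L → dist u t < η) →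
      |(∫ ω, (((jumpTimes (fun v => X v ω) R 0 (s + L)).ncard : ℝ) -
        ((jumpTimes (fun v => X v ω) R 0 s).ncard : ℝ)) ∂μ) / L -
        ∑ q ∈ offDiagPairs R, c q.1 * Q q.1 q.2| < ε := by
    intro s L hL hs
    have hL' : (0 : ℝ) < L := NNReal.coe_pos.2 hL
    have h := hX.abs_integral_ncard_sub_le R (fun u h1 h2 i => (H (hs u h1 h2) i).le)
    rw [← hX.integral_ncard_sub] at h
    have e1 : ∑ q ∈ offDiagPairs R, c q.1 * (L * Q q.1 q.2) =
        L * ∑ q ∈ offDiagPairs R, c q.1 * Q q.1 q.2 := by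
      rw [Finset.mul_sum]
      exact Finset.sum_congr rfl fun q _ => by ring
    have e2 : ∑ q ∈ offDiagPairs R, ε / (|K| + 1) * (L * Q q.1 q.2) =
        L * (ε / (|K| + 1) * K) := by
      rw [← Finset.mul_sum, ← Finset.mul_sum]
      ring
    rw [e1, e2] at h
    rw [div_sub' hL'.ne', abs_div, abs_of_pos hL', div_lt_iff₀ hL']
    refine h.trans_lt ?_
    rw [mul_comm]
    gcongr
    calc ε / (|K| + 1) * K ≤ ε / (|K| + 1) * |K| := by gcongr; exact le_abs_self K
      _ < ε / (|K| + 1) * (|K| + 1) := by gcongr; linarith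
      _ = ε := by field_simp
  have hsmall : ∀ᶠ δ : ℝ in increments t, |δ| < η :=
    nhdsWithin_le_nhds (by simpa [Metric.ball, Real.dist_eq] using Metric.ball_mem_nhds (0 : ℝ) hη)
  filter_upwards [hsmall, self_mem_nhdsWithin] with δ hδ hδt
  rw [Real.dist_eq, incrementRatio]
  rcases lt_or_gt_of_ne hδt.1 with hneg | hpos
  · have e : t = ((t : ℝ) + δ).toNNReal + (-δ).toNNReal := by
      rw [← Real.toNNReal_add hδt.2 (by linarith)]; simp
    have h := key ((t : ℝ) + δ).toNNReal (-δ).toNNReal (Real.toNNReal_pos.2 (by linarith)) (by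
      rw [← e]
      intro u h1 h2
      have h1' := Real.toNNReal_le_iff_le_coe.1 h1
      have h2' := NNReal.coe_le_coe.2 h2
      rw [NNReal.dist_eq, abs_sub_comm, abs_of_nonneg (by linarith)]
      rw [abs_of_neg hneg] at hδ
      linarith)
    -- For `δ < 0` both the increment and the divisor change sign, so the quotient is unchanged.
    rw [← e, Real.coe_toNNReal _ (by linarith : 0 ≤ -δ), div_neg, ← neg_div, ← integral_neg] at h
    simpa only [neg_sub] using h
  · have e : ((t : ℝ) + δ).toNNReal = t + δ.toNNReal := by
      rw [Real.toNNReal_add t.coe_nonneg hpos.le, Real.toNNReal_coe]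
    have h := key t δ.toNNReal (Real.toNNReal_pos.2 hpos) (by
      intro u h1 h2
      have h1' := NNReal.coe_le_coe.2 h1
      have h2' := NNReal.coe_le_coe.2 h2
      rw [NNReal.coe_add, Real.coe_toNNReal _ hpos.le] at h2'
      rw [NNReal.dist_eq, abs_of_nonneg (by linarith)]
      rw [abs_of_pos hpos] at hδ
      linarith)
    rw [← e, Real.coe_toNNReal _ hpos.le] at h
    exact h

end Rates

/-- Limits along `increments t` are then unique, so the value of `limUnder` can be identified. -/
lemma increments_neBot (t : ℝ≥0) : (increments t).NeBot := by
  refine Filter.neBot_of_le (f := 𝓝[>] (0 : ℝ)) (nhdsWithin_mono _ fun δ hδ => ?_)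
  have hδ : 0 < δ := hδ
  exact ⟨hδ.ne', by positivity⟩

/-! ### The three counts and the partition of state pairs. -/

section Counts

variable {Ω E : Type*} {X : ℝ≥0 → Ω → E} (W F : Set E)

/-- The bound `0 < u` is already part of `JumpsAt`. -/
lemma numFailures_eq : numFailures X W F =
    fun t ω => (jumpTimes (fun v => X v ω) (fun i j => i ∈ W ∧ j ∈ F) 0 t).ncard := by
  funext t ω
  refine congrArg Set.ncard (Set.ext fun u => ⟨?_, ?_⟩)
  · rintro ⟨h1, w, hw, f, hf, h⟩
    exact ⟨h.1, h1, w, f, ⟨hw, hf⟩, h⟩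
  · rintro ⟨-, h1, w, f, ⟨hw, hf⟩, h⟩
    exact ⟨h1, w, hw, f, hf, h⟩

lemma numRepairs_eq : numRepairs X W F =
    fun t ω => (jumpTimes (fun v => X v ω) (fun i j => i ∈ F ∧ j ∈ W) 0 t).ncard :=
  numFailures_eq F W

lemma numInner_eq : numInner X W F =
    fun t ω => (jumpTimes (fun v => X v ω)
      (fun i j => i ∈ W ∧ j ∈ W ∨ i ∈ F ∧ j ∈ F) 0 t).ncard := by
  funext t ω
  refine congrArg Set.ncard (Set.ext fun u => ⟨?_, ?_⟩)
  · rintro ⟨h1, ⟨w, hw, f, hf, h⟩ | ⟨w, hw, f, hf, h⟩⟩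
    · exact ⟨h.1, h1, w, f, Or.inl ⟨hw, hf⟩, h⟩
    · exact ⟨h.1, h1, w, f, Or.inr ⟨hw, hf⟩, h⟩
  · rintro ⟨-, h1, w, f, ⟨hw, hf⟩ | ⟨hw, hf⟩, h⟩
    · exact ⟨h1, Or.inl ⟨w, hw, f, hf, h⟩⟩
    · exact ⟨h1, Or.inr ⟨w, hw, f, hf, h⟩⟩

/-- As `F = Wᶜ`, each pair of different states satisfies exactly one of the three relations. -/
lemma sum_offDiagPairs_partition [Fintype E] [DecidableEq E] {W F : Set E} (hWF : IsCompl W F)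
    (f : E → E → ℝ) :
    ∑ q ∈ offDiagPairs (fun i j => i ∈ W ∧ j ∈ W ∨ i ∈ F ∧ j ∈ F), f q.1 q.2 +
      ∑ q ∈ offDiagPairs (fun i j => i ∈ W ∧ j ∈ F), f q.1 q.2 +
      ∑ q ∈ offDiagPairs (fun i j => i ∈ F ∧ j ∈ W), f q.1 q.2 =
      ∑ h, ∑ j with j ≠ h, f h j := by
  classical
  obtain rfl : F = Wᶜ := hWF.compl_eq.symm
  simp only [offDiagPairs, Finset.sum_filter, Fintype.sum_prod_type, ← Finset.sum_add_distrib]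
  refine Finset.sum_congr rfl fun h _ => Finset.sum_congr rfl fun j _ => ?_
  by_cases h1 : h ∈ W <;> by_cases h2 : j ∈ W <;> by_cases h3 : j = h <;>
    simp_all [eq_comm]

end Counts

end MarkovReliability

open MarkovReliability in
theorem mainTheorem3 {Ω E : Type*} [MeasurableSpace Ω] [Fintype E] [DecidableEq E]
    (μ : Measure Ω) [IsProbabilityMeasure μ] (X : ℝ≥0 → Ω → E) (α : E → ℝ) (Q : Matrix E E ℝ)
    (hX : IsMarkovProcess μ X α Q) (W F : Set E) (hWF : IsCompl W F) (t : ℝ≥0) :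
    -- the expected numbers of transitions are finite
    (∀ s, Integrable (fun ω => (numFailures X W F s ω : ℝ)) μ ∧
      Integrable (fun ω => (numRepairs X W F s ω : ℝ)) μ ∧
      Integrable (fun ω => (numInner X W F s ω : ℝ)) μ) ∧
    -- the limits that define the three rates exist
    Tendsto (incrementRatio μ (numFailures X W F) t) (increments t) (𝓝 (rof μ X W F t)) ∧
    Tendsto (incrementRatio μ (numRepairs X W F) t) (increments t) (𝓝 (ror μ X W F t)) ∧
    Tendsto (incrementRatio μ (numInner X W F) t) (increments t) (𝓝 (roi μ X W F t)) ∧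
    -- the relation; its right-hand side is the total mobility rate
    roi μ X W F t + rof μ X W F t + ror μ X W F t =
      ∑ i, ∑ h, α i * (NormedSpace.exp ((t : ℝ) • Q)) i h * ∑ j with j ≠ h, Q h j ∧
    roi μ X W F t + rof μ X W F t + ror μ X W F t = tmr α Q t := by
  have := increments_neBot t
  have hf := hX.tendsto_incrementRatio (fun i j => i ∈ W ∧ j ∈ F) t
  have hr := hX.tendsto_incrementRatio (fun i j => i ∈ F ∧ j ∈ W) t
  have hi := hX.tendsto_incrementRatio (fun i j => i ∈ W ∧ j ∈ W ∨ i ∈ F ∧ j ∈ F) t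
  rw [← numFailures_eq W F] at hf
  rw [← numRepairs_eq W F] at hr
  rw [← numInner_eq W F] at hi
  have key : roi μ X W F t + rof μ X W F t + ror μ X W F t =
      ∑ i, ∑ h, α i * (NormedSpace.exp ((t : ℝ) • Q)) i h * ∑ j with j ≠ h, Q h j := by
    rw [roi, rof, ror, rate, rate, rate, hf.limUnder_eq, hr.limUnder_eq, hi.limUnder_eq,
      sum_offDiagPairs_partition hWF (fun h j => μ.real (X t ⁻¹' {h}) * Q h j), Finset.sum_comm]
    obtain ⟨P, hP, hQ, hM⟩ := hX.exists_transition
    rw [Finset.sum_comm]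
    conv_rhs => rw [Finset.sum_comm]
    -- For fixed `h`, both sides are `P(X t = h)` times the total rate of leaving `h`.
    refine Finset.sum_congr rfl fun h _ => ?_
    rw [← Finset.mul_sum, ← Finset.sum_mul, hX.measureReal_state hM, hP.eq_exp hQ]
  refine ⟨fun s => ?_, tendsto_nhds_limUnder ⟨_, hf⟩, tendsto_nhds_limUnder ⟨_, hr⟩,
    tendsto_nhds_limUnder ⟨_, hi⟩, key, key⟩
  rw [numFailures_eq, numRepairs_eq, numInner_eq]
  have H : ∀ R : E → E → Prop,
      Integrable (fun ω => ((jumpTimes (fun v => X v ω) R 0 s).ncard : ℝ)) μ := fun R => by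
    simpa only [zero_add] using hX.integrable_ncard R 0 s
  exact ⟨H _, H _, H _⟩
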